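/- Call a matrix $S=[s_{ij}]_{i,j\ge 0}$ of complex numbers a bounded Schur multiplier if $[t_{ij}]\mapsto[s_{ij}t_{ij}]$ is a bounded map of $\mathcal B(\ell^2(\mathbb N_0))$ (operators being identified with their matrices in the standard basis) into itself; let $\|S\|_m$ be the norm of this map, and put $\|S\|_m=\infty$ if $S$ is not a bounded Schur multiplier. For a complex matrix $A=[a_{ij}]_{i,j\ge0}$ let $$\mathfrak s(A)=\sup\bigl\{\|S\|_m : S=[s_{ij}]_{i,j\ge 0},\ |s_{ij}|\le |a_{ij}| \text{ for all } i,j\bigr\}\in[0,\infty].$$ **Theorem.** Let $(a_k)_{k\in\mathbb Z}$ be a square summable sequence of complex numbers and let $A=[a_{i-j}]_{i,j\ge 0}$. Then $$\frac1{\sqrt2}\,\|(a_k)\|_2\ \le\ \mathfrak s(A)\ \le\ \|(a_k)\|_2,\qquad \|(a_k)\|_2=\Bigl(\sum_{k\in\mathbb Z}|a_k|^2\Bigr)^{1/2}.$$ -/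

import Mathlib

open scoped ENNReal

noncomputable section

namespace SchurToeplitz

/-- The complex Hilbert space of square summable sequences indexed by `{0, 1, 2, …}`. -/
abbrev H : Type := lp (fun _ : ℕ => ℂ) 2

/-- The `(i, j)` entry `⟨e_i, T e_j⟩` of a bounded operator in the standard basis. -/
def entry (T : H →L[ℂ] H) (i j : ℕ) : ℂ := (T (lp.single 2 j (1 : ℂ)) : H) i

/-- The operator norm of an infinite matrix: `‖R‖` if the matrix is that of a (necessarily unique)
bounded operator `R`, and `∞` if it is the matrix of no bounded operator. -/
def matrixNorm (t : ℕ → ℕ → ℂ) : ℝ≥0∞ :=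
  ⨅ (R : H →L[ℂ] H) (_ : ∀ i j, entry R i j = t i j), ‖R‖ₑ

/-- The Schur multiplier norm `‖S‖_m`: the norm of the map `[t_ij] ↦ [s_ij t_ij]` on the bounded
operators, which is `∞` if this is not a bounded map of the bounded operators into themselves. -/
def schurNorm (s : ℕ → ℕ → ℂ) : ℝ≥0∞ :=
  ⨆ (T : H →L[ℂ] H) (_ : ‖T‖ ≤ 1), matrixNorm (fun i j => s i j * entry T i j)

/-- The matrices dominated entrywise in absolute value by `A`. -/
def dominated (A : ℕ → ℕ → ℂ) : Set (ℕ → ℕ → ℂ) :=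
  {s | ∀ i j, ‖s i j‖ ≤ ‖A i j‖}

/-- The Schur bound of `A`: the supremum of the Schur multiplier norms of the matrices
dominated by `A`. -/
def schurBound (A : ℕ → ℕ → ℂ) : ℝ≥0∞ := ⨆ s ∈ dominated A, schurNorm s

/-- The Toeplitz matrix `[a_{i-j}]`, where `i - j` is the difference in `ℤ`. -/
def toeplitz (a : ℤ → ℂ) (i j : ℕ) : ℂ := a ((i : ℤ) - (j : ℤ))

end SchurToeplitz

end

/-! ### Upper bound: matrices with uniformly square summable columns. -/

namespace SchurToeplitz

/-! Upper bound: row `i` of the Schur product of `S` and `T` is row `i` of `T D_i`, with `D_i` the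
diagonal matrix of row `i` of `S`. For a contraction `T`, summing squares over `i` and exchanging
sums leaves only the column norms of `S`, and each column of a dominated matrix is bounded by a
stretch of `a` (`schurNorm_le_of_column`).

Lower bound: keep finitely many diagonals and twist `a k` by phases so that the symbol `f` has mean
modulus at least `‖a‖₂/√2` over the `N`-th roots of unity (`exists_phases_le_sum_norm`). Testing
against the contraction with symbol `conj f / |f|` gives a matrix whose full-length columns each sum
to the mean of `|f|`. Pairing with indicator vectors bounds the multiplier norm below, up to a
boundary factor tending to 1 (`ofReal_le_schurNorm`). -/

lemma norm_sq_eq_tsum {ι : Type*} (x : lp (fun _ : ι => ℂ) 2) : ‖x‖ ^ 2 = ∑' i, ‖x i‖ ^ 2 := by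
  have h := lp.norm_rpow_eq_tsum (p := 2) (by norm_num) x
  simpa using h

lemma summable_norm_sq {ι : Type*} (x : lp (fun _ : ι => ℂ) 2) :
    Summable fun i => ‖x i‖ ^ 2 := by
  have h := (lp.memℓp x).summable (by norm_num)
  simpa using h

lemma memlp_two {ι : Type*} {x : ι → ℂ} (h : Summable fun i => ‖x i‖ ^ 2) : Memℓp x 2 :=
  memℓp_gen (by simpa using h)

/-- Coordinatewise multiplication of a square summable sequence by a bounded one. -/
noncomputable def mulSeq {c : ℝ} (s : ℕ → ℂ) (hs : ∀ j, ‖s j‖ ≤ c) : H →ₗ[ℂ] H where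
  toFun x := ⟨fun j => s j * x j, memlp_two <| by
    refine Summable.of_nonneg_of_le (fun _ => by positivity) (fun j => ?_)
      ((summable_norm_sq x).mul_left (c ^ 2))
    rw [norm_mul, mul_pow]
    gcongr
    exact hs j⟩
  map_add' x y := by ext j; simp [mul_add]; rfl
  map_smul' r x := by ext j; simp [mul_left_comm]

@[simp]
lemma mulSeq_apply {c : ℝ} (s : ℕ → ℂ) (hs : ∀ j, ‖s j‖ ≤ c) (x : H) (j : ℕ) :
    mulSeq s hs x j = s j * x j := rfl

lemma mulSeq_single {c : ℝ} (s : ℕ → ℂ) (hs : ∀ j, ‖s j‖ ≤ c) (j : ℕ) :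
    mulSeq s hs (lp.single 2 j (1 : ℂ)) = s j • lp.single 2 j (1 : ℂ) := by
  ext k
  by_cases h : k = j
  · subst h; simp
  · simp [lp.single_apply, h]

/-- A matrix whose columns are bounded in `ℓ²` by `c` is a Schur multiplier of norm at most `c`. -/
theorem schurNorm_le_of_column {s : ℕ → ℕ → ℂ} {c : ℝ} (hc : 0 ≤ c)
    (hsum : ∀ j, Summable fun i => ‖s i j‖ ^ 2) (hle : ∀ j, ∑' i, ‖s i j‖ ^ 2 ≤ c ^ 2) :
    schurNorm s ≤ ENNReal.ofReal c := by
  have hs : ∀ i j, ‖s i j‖ ≤ c := fun i j =>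
    (sq_le_sq₀ (norm_nonneg _) hc).1
      (((hsum j).le_tsum i fun _ _ => by positivity).trans (hle j))
  refine iSup₂_le fun T hT => ?_
  have hprod : ∀ x : H, Summable fun p : ℕ × ℕ => ‖s p.2 p.1‖ ^ 2 * ‖x p.1‖ ^ 2 := fun x => by
    refine (summable_prod_of_nonneg fun _ => by positivity).2
      ⟨fun j => (hsum j).mul_right (‖x j‖ ^ 2), ?_⟩
    refine Summable.of_nonneg_of_le (fun j => tsum_nonneg fun _ => by positivity) (fun j => ?_)
      ((summable_norm_sq x).mul_left (c ^ 2))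
    simp only [tsum_mul_right]
    gcongr
    exact hle j
  have hprod' : ∀ x : H, Summable fun p : ℕ × ℕ => ‖s p.1 p.2‖ ^ 2 * ‖x p.2‖ ^ 2 :=
    fun x => (hprod x).prod_symm
  have hrow : ∀ (x : H) i, ‖mulSeq (s i) (hs i) x‖ ^ 2 = ∑' j, ‖s i j‖ ^ 2 * ‖x j‖ ^ 2 := by
    intro x i
    rw [norm_sq_eq_tsum]
    simp [mul_pow]
  have hcoord : ∀ (x : H) i,
      ‖(T (mulSeq (s i) (hs i) x) : H) i‖ ^ 2 ≤ ∑' j, ‖s i j‖ ^ 2 * ‖x j‖ ^ 2 := by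
    intro x i
    rw [← hrow]
    gcongr
    exact (lp.norm_apply_le_norm two_ne_zero _ i).trans
      ((T.le_opNorm _).trans (mul_le_of_le_one_left (norm_nonneg _) hT))
  have hRsum : ∀ x : H, Summable fun i => ‖(T (mulSeq (s i) (hs i) x) : H) i‖ ^ 2 := fun x =>
    Summable.of_nonneg_of_le (fun _ => by positivity) (hcoord x) (hprod' x).prod
  -- The Schur product, built row by row with a different diagonal factor for each output
  -- coordinate.
  let R₀ : H →ₗ[ℂ] H :=
    { toFun := fun x => ⟨fun i => (T (mulSeq (s i) (hs i) x) : H) i, memlp_two (hRsum x)⟩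
      map_add' := fun x y => by ext i; simp; rfl
      map_smul' := fun r x => by ext i; simp }
  have hR₀ : ∀ x, ‖R₀ x‖ ≤ c * ‖x‖ := fun x => by
    refine (sq_le_sq₀ (norm_nonneg _) (by positivity)).1 ?_
    calc ‖R₀ x‖ ^ 2 = ∑' i, ‖(T (mulSeq (s i) (hs i) x) : H) i‖ ^ 2 := norm_sq_eq_tsum _
      _ ≤ ∑' i, ∑' j, ‖s i j‖ ^ 2 * ‖x j‖ ^ 2 :=
          (hRsum x).tsum_le_tsum (hcoord x) (hprod' x).prod
      _ = ∑' j, ∑' i, ‖s i j‖ ^ 2 * ‖x j‖ ^ 2 := (hprod' x).tsum_comm.symm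
      _ ≤ ∑' j, c ^ 2 * ‖x j‖ ^ 2 := by
          refine (hprod x).prod.tsum_le_tsum (fun j => ?_) ((summable_norm_sq x).mul_left _)
          rw [tsum_mul_right]
          gcongr
          exact hle j
      _ = (c * ‖x‖) ^ 2 := by rw [tsum_mul_left, ← norm_sq_eq_tsum, mul_pow]
  refine (iInf₂_le (R₀.mkContinuous c hR₀) fun i j => ?_).trans ?_
  · change (T (mulSeq (s i) (hs i) _) : H) i = _
    rw [mulSeq_single, map_smul]
    rfl
  · rw [← ofReal_norm]
    exact ENNReal.ofReal_le_ofReal (R₀.mkContinuous_norm_le hc hR₀)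

theorem schurBound_toeplitz_le (a : lp (fun _ : ℤ => ℂ) 2) :
    schurBound (toeplitz a) ≤ ENNReal.ofReal ‖a‖ := by
  refine iSup₂_le fun s hs => ?_
  have hinj : ∀ j : ℕ, Function.Injective fun i : ℕ => (i : ℤ) - j := fun j i i' h => by
    simpa using h
  have hle : ∀ i j : ℕ, ‖s i j‖ ^ 2 ≤ ‖a ((i : ℤ) - j)‖ ^ 2 := fun i j => by
    gcongr
    exact hs i j
  have hcol : ∀ j : ℕ, Summable fun i : ℕ => ‖a ((i : ℤ) - j)‖ ^ 2 := fun j =>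
    (summable_norm_sq a).comp_injective (hinj j)
  have hsum : ∀ j, Summable fun i => ‖s i j‖ ^ 2 := fun j =>
    Summable.of_nonneg_of_le (fun _ => by positivity) (fun i => hle i j) (hcol j)
  refine schurNorm_le_of_column (norm_nonneg _) hsum fun j => ?_
  rw [norm_sq_eq_tsum]
  exact (hsum j).tsum_le_tsum_of_inj _ (hinj j) (fun _ _ => by positivity) (fun i => hle i j)
    (summable_norm_sq a)

end SchurToeplitz
-- Choice of phases: second and fourth moments.
namespace SchurToeplitz

open Finset ComplexConjugate

/-- Choosing one phase among the fourth roots of unity does not decrease a functional whose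
average over the four choices is at least `q`. -/
lemma exists_phase {F : ℂ → ℝ} {q : ℝ}
    (h : 4 * q ≤ F 1 + F (-1) + F Complex.I + F (-Complex.I)) :
    ∃ e : ℂ, ‖e‖ = 1 ∧ q ≤ F e := by
  by_contra! H
  have h1 := H 1 (by simp)
  have h2 := H (-1) (by simp)
  have h3 := H Complex.I (by simp)
  have h4 := H (-Complex.I) (by simp)
  linarith

/-- Over the fourth roots of unity both `e` and `e ^ 2` average to 0, so the cross terms vanish as
for a uniform phase. The two sides differ by `4 * ‖w‖ ^ 4`. -/
lemma sum_phases_sq (z w : ℂ) (c r : ℝ) :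
    4 * (c * (‖z‖ ^ 2 + (‖w‖ ^ 2 + r)) - (‖z‖ ^ 4 + 4 * ‖z‖ ^ 2 * (‖w‖ ^ 2 + r) +
        2 * (‖w‖ ^ 2 + r) ^ 2)) ≤
      (fun e : ℂ => c * (‖z + e * w‖ ^ 2 + r) - (‖z + e * w‖ ^ 4 + 4 * ‖z + e * w‖ ^ 2 * r +
        2 * r ^ 2)) 1 +
      (fun e : ℂ => c * (‖z + e * w‖ ^ 2 + r) - (‖z + e * w‖ ^ 4 + 4 * ‖z + e * w‖ ^ 2 * r +
        2 * r ^ 2)) (-1) +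
      (fun e : ℂ => c * (‖z + e * w‖ ^ 2 + r) - (‖z + e * w‖ ^ 4 + 4 * ‖z + e * w‖ ^ 2 * r +
        2 * r ^ 2)) Complex.I +
      (fun e : ℂ => c * (‖z + e * w‖ ^ 2 + r) - (‖z + e * w‖ ^ 4 + 4 * ‖z + e * w‖ ^ 2 * r +
        2 * r ^ 2)) (-Complex.I) := by
  have h4 : ∀ x : ℂ, ‖x‖ ^ 4 = (‖x‖ ^ 2) ^ 2 := fun x => by ring
  simp only [h4, ← Complex.normSq_eq_norm_sq, Complex.normSq_apply]
  simp
  nlinarith [sq_nonneg (w.re ^ 2 + w.im ^ 2)]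

/-- Phases for which the second and fourth moments of a family of sums compare as they do on
average over independent uniform phases. -/
theorem exists_phases {Θ κ : Type*} [Fintype Θ] [DecidableEq κ] (u : Θ → κ → ℂ)
    (hu : ∀ θ k, ‖u θ k‖ = 1) (b : κ → ℂ) (c : ℝ) (K : Finset κ) (z : Θ → ℂ) :
    ∃ e : κ → ℂ, (∀ k, ‖e k‖ = 1) ∧
      ∑ θ, (c * (‖z θ‖ ^ 2 + ∑ k ∈ K, ‖b k‖ ^ 2) - (‖z θ‖ ^ 4 +
        4 * ‖z θ‖ ^ 2 * (∑ k ∈ K, ‖b k‖ ^ 2) + 2 * (∑ k ∈ K, ‖b k‖ ^ 2) ^ 2)) ≤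
      ∑ θ, (c * ‖z θ + ∑ k ∈ K, e k * b k * u θ k‖ ^ 2 -
        ‖z θ + ∑ k ∈ K, e k * b k * u θ k‖ ^ 4) := by
  induction K using Finset.induction generalizing z with
  | empty => exact ⟨fun _ => 1, by simp, by simp⟩
  | insert k₀ K hk ih =>
    simp only [sum_insert hk]
    set r := ∑ k ∈ K, ‖b k‖ ^ 2
    obtain ⟨e₀, he₀, h₀⟩ := exists_phase
      (F := fun e => ∑ θ, (c * (‖z θ + e * (b k₀ * u θ k₀)‖ ^ 2 + r) -
        (‖z θ + e * (b k₀ * u θ k₀)‖ ^ 4 + 4 * ‖z θ + e * (b k₀ * u θ k₀)‖ ^ 2 * r + 2 * r ^ 2)))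
      (q := ∑ θ, (c * (‖z θ‖ ^ 2 + (‖b k₀‖ ^ 2 + r)) - (‖z θ‖ ^ 4 +
        4 * ‖z θ‖ ^ 2 * (‖b k₀‖ ^ 2 + r) + 2 * (‖b k₀‖ ^ 2 + r) ^ 2))) (by
        rw [mul_sum]
        simp only [← sum_add_distrib]
        refine sum_le_sum fun θ _ => ?_
        have := sum_phases_sq (z θ) (b k₀ * u θ k₀) c r
        rwa [norm_mul (b k₀), hu, mul_one] at this)
    -- The term whose phase is now fixed is absorbed into the offset `z`.
    obtain ⟨e, he, h⟩ := ih fun θ => z θ + e₀ * (b k₀ * u θ k₀)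
    refine ⟨Function.update e k₀ e₀, fun k => ?_, h₀.trans (h.trans_eq ?_)⟩
    · by_cases hkk : k = k₀
      · subst hkk; simpa
      · simpa [hkk] using he k
    · have : ∀ θ, z θ + (Function.update e k₀ e₀ k₀ * b k₀ * u θ k₀ +
          ∑ k ∈ K, Function.update e k₀ e₀ k * b k * u θ k) =
          z θ + e₀ * (b k₀ * u θ k₀) + ∑ k ∈ K, e k * b k * u θ k := fun θ => by
        rw [Function.update_self, ← add_assoc, ← mul_assoc]
        congr 1
        refine sum_congr rfl fun k hkK => ?_
        rw [Function.update_of_ne (ne_of_mem_of_not_mem hkK hk)]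
      simp only [this]

/-- A derandomised Khintchine inequality: the phases can be chosen so that the average modulus of
the family of sums is at least `1 / √2` times the `ℓ²` norm of the coefficients. -/
theorem exists_phases_le_sum_norm {Θ κ : Type*} [Fintype Θ] [DecidableEq κ] (u : Θ → κ → ℂ)
    (hu : ∀ θ k, ‖u θ k‖ = 1) (b : κ → ℂ) (K : Finset κ) :
    ∃ e : κ → ℂ, (∀ k, ‖e k‖ = 1) ∧
      Fintype.card Θ * (√(∑ k ∈ K, ‖b k‖ ^ 2) / √2) ≤
        ∑ θ, ‖∑ k ∈ K, e k * b k * u θ k‖ := by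
  have hr : 0 ≤ ∑ k ∈ K, ‖b k‖ ^ 2 := by positivity
  set σ := √(∑ k ∈ K, ‖b k‖ ^ 2) with hσ
  have hσ2 : ∑ k ∈ K, ‖b k‖ ^ 2 = σ ^ 2 := (Real.sq_sqrt hr).symm
  -- With the factor `6 * σ ^ 2` the averaged bound is `6σ⁴ - 2σ⁴ = 4σ⁴`.
  obtain ⟨e, he, h⟩ := exists_phases u hu b (6 * σ ^ 2) K 0
  refine ⟨e, he, ?_⟩
  rcases (show 0 ≤ σ from Real.sqrt_nonneg _).eq_or_lt with h0 | h0
  · rw [← h0]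
    simp only [zero_div, mul_zero]
    positivity
  have h2 : √2 ^ 2 = 2 := Real.sq_sqrt (by norm_num)
  have h2' : (0 : ℝ) < √2 := by positivity
  -- Equality holds at `t = √2 * σ`, a double root; dividing `4σ⁴` by `4√2σ³` gives `σ/√2`.
  have hpt : ∀ t : ℝ, 0 ≤ t → 6 * σ ^ 2 * t ^ 2 - t ^ 4 ≤ 4 * √2 * σ ^ 3 * t := fun t ht => by
    have h3 : 0 ≤ t * ((t - √2 * σ) ^ 2 * (t + 2 * √2 * σ)) := by positivity
    have h4 : t * ((t - √2 * σ) ^ 2 * (t + 2 * √2 * σ)) =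
        t ^ 4 - 3 * √2 ^ 2 * σ ^ 2 * t ^ 2 + 2 * √2 ^ 2 * √2 * σ ^ 3 * t := by ring
    rw [h4, h2] at h3
    linarith
  have hle := h.trans (sum_le_sum fun θ _ => hpt _ (norm_nonneg _))
  rw [← mul_sum, hσ2] at hle
  simp only [Pi.zero_apply, zero_add, norm_zero, sum_const, card_univ, nsmul_eq_mul] at hle
  have h5 : 0 < 4 * √2 * σ ^ 3 := by positivity
  refine le_of_mul_le_mul_left (le_trans (le_of_eq ?_) hle) h5
  field_simp
  ring

end SchurToeplitz
-- Finite corners and contractions with prescribed symbol.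
namespace SchurToeplitz

open Finset ComplexConjugate Matrix
open scoped Matrix.Norms.L2Operator

/-- Restriction of a sequence to its first `N` coordinates. -/
noncomputable def restrict (N : ℕ) : H →L[ℂ] EuclideanSpace ℂ (Fin N) :=
  LinearMap.mkContinuous
    { toFun := fun x => WithLp.toLp 2 fun i : Fin N => x i
      map_add' := fun x y => by ext i; simp
      map_smul' := fun r x => by ext i; simp } 1 fun x => by
    refine (sq_le_sq₀ (norm_nonneg _) (by positivity)).1 ?_
    rw [one_mul, norm_sq_eq_tsum, EuclideanSpace.norm_sq_eq]
    change ∑ i : Fin N, ‖x i‖ ^ 2 ≤ _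
    rw [Fin.sum_univ_eq_sum_range fun i => ‖x i‖ ^ 2]
    exact (summable_norm_sq x).sum_le_tsum _ fun _ _ => by positivity

lemma norm_restrict_le (N : ℕ) : ‖restrict N‖ ≤ 1 := LinearMap.mkContinuous_norm_le _ zero_le_one _

@[simp]
lemma restrict_apply (N : ℕ) (x : H) (i : Fin N) : restrict N x i = x i := rfl

lemma restrict_single (N : ℕ) (i : Fin N) :
    restrict N (lp.single 2 (i : ℕ) (1 : ℂ)) = EuclideanSpace.single i (1 : ℂ) := by
  ext k
  by_cases h : k = i
  · subst h; simp
  · simp [lp.single_apply, h, Fin.val_inj]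

/-- The operator on `ℓ²` whose matrix has the given finite corner. -/
noncomputable def ofCorner {N : ℕ} (M : Matrix (Fin N) (Fin N) ℂ) : H →L[ℂ] H :=
  (restrict N).adjoint ∘L (toEuclideanCLM (𝕜 := ℂ) M) ∘L restrict N

lemma norm_ofCorner_le {N : ℕ} (M : Matrix (Fin N) (Fin N) ℂ) : ‖ofCorner M‖ ≤ ‖M‖ := by
  have h := norm_restrict_le N
  calc ‖ofCorner M‖ ≤ ‖(restrict N).adjoint‖ *
        (‖toEuclideanCLM (𝕜 := ℂ) M‖ * ‖restrict N‖) :=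
        (ContinuousLinearMap.opNorm_comp_le _ _).trans
          (mul_le_mul_of_nonneg_left (ContinuousLinearMap.opNorm_comp_le _ _) (norm_nonneg _))
    _ ≤ 1 * (‖toEuclideanCLM (𝕜 := ℂ) M‖ * 1) := by
        gcongr
        rwa [LinearIsometryEquiv.norm_map]
    _ = ‖M‖ := by rw [one_mul, mul_one]; rfl

lemma entry_eq_inner (T : H →L[ℂ] H) (i j : ℕ) :
    entry T i j = inner ℂ (lp.single 2 i (1 : ℂ) : H) (T (lp.single 2 j (1 : ℂ))) := by
  rw [lp.inner_single_left]
  simp [entry]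

lemma entry_ofCorner {N : ℕ} (M : Matrix (Fin N) (Fin N) ℂ) (i j : Fin N) :
    entry (ofCorner M) i j = M i j := by
  rw [entry_eq_inner, ofCorner, ContinuousLinearMap.comp_apply, ContinuousLinearMap.comp_apply,
    ContinuousLinearMap.adjoint_inner_right, restrict_single, restrict_single]
  simp [EuclideanSpace.inner_single_left, ofLp_toEuclideanCLM]

/-- The normalised discrete Fourier matrix associated with `ζ`. -/
noncomputable def fourierMatrix (N : ℕ) (ζ : ℂ) : Matrix (Fin N) (Fin N) ℂ :=
  Matrix.of fun i θ => ζ ^ ((i : ℕ) * (θ : ℕ)) / √N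

lemma fourierMatrix_mem_unitary {N : ℕ} [NeZero N] {ζ : ℂ} (hζ : IsPrimitiveRoot ζ N) :
    fourierMatrix N ζ ∈ unitaryGroup (Fin N) ℂ := by
  have hnorm : ‖ζ‖ = 1 := hζ.norm'_eq_one (NeZero.ne N)
  have hz : ζ ≠ 0 := hζ.ne_zero (NeZero.ne N)
  have hN : ((√(N : ℝ) : ℝ) : ℂ) * (√(N : ℝ) : ℝ) = N := by
    rw [← Complex.ofReal_mul, Real.mul_self_sqrt (Nat.cast_nonneg _), Complex.ofReal_natCast]
  have hN0 : (N : ℂ) ≠ 0 := NeZero.ne _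
  rw [mem_unitaryGroup_iff']
  ext θ φ
  have hterm : ∀ i : Fin N, (star (fourierMatrix N ζ)) θ i * fourierMatrix N ζ i φ =
      (ζ ^ ((φ : ℤ) - (θ : ℤ))) ^ (i : ℕ) / N := fun i => by
    rw [star_apply, fourierMatrix, of_apply, of_apply, star_div₀, div_mul_div_comm]
    simp only [RCLike.star_def, Complex.conj_ofReal, map_pow, hN]
    rw [← Complex.inv_eq_conj hnorm, zpow_sub₀ hz, zpow_natCast, zpow_natCast, div_pow, ← pow_mul,
      ← pow_mul, inv_pow, mul_comm (φ : ℕ), mul_comm (θ : ℕ)]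
    congr 1
    rw [div_eq_mul_inv, mul_comm]
  rw [mul_apply, sum_congr rfl fun i _ => hterm i, ← sum_div,
    Fin.sum_univ_eq_sum_range fun i => (ζ ^ ((φ : ℤ) - (θ : ℤ))) ^ i]
  by_cases h : θ = φ
  · subst h
    simp [hN0]
  · rw [one_apply_ne h, div_eq_zero_iff]
    left
    have h1 : ζ ^ ((φ : ℤ) - (θ : ℤ)) ≠ 1 := fun h1 => by
      rw [hζ.zpow_eq_one_iff_dvd] at h1
      have h2 := Int.eq_zero_of_abs_lt_dvd h1 (by rw [abs_lt]; omega)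
      exact h (Fin.ext (by omega))
    refine (mul_eq_zero.1 ?_).resolve_left (sub_ne_zero.2 h1)
    rw [mul_geom_sum, ← zpow_natCast, ← _root_.zpow_mul, mul_comm, _root_.zpow_mul, zpow_natCast,
      hζ.pow_eq_one, _root_.one_zpow, sub_self]

/-- A function bounded by `1` on the `N`-th roots of unity is the symbol of a contraction which is
a Toeplitz matrix on its `N × N` corner. -/
lemma exists_contraction_of_symbol {N : ℕ} [NeZero N] {ζ : ℂ} (hζ : IsPrimitiveRoot ζ N)
    (g : Fin N → ℂ) (hg : ∀ θ, ‖g θ‖ ≤ 1) :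
    ∃ T : H →L[ℂ] H, ‖T‖ ≤ 1 ∧ ∀ i < N, ∀ j < N,
      entry T i j = (∑ θ : Fin N, g θ * ζ ^ (((i : ℤ) - j) * (θ : ℕ))) / N := by
  have hnorm : ‖ζ‖ = 1 := hζ.norm'_eq_one (NeZero.ne N)
  have hz : ζ ≠ 0 := hζ.ne_zero (NeZero.ne N)
  have hN : ((√(N : ℝ) : ℝ) : ℂ) * (√(N : ℝ) : ℝ) = N := by
    rw [← Complex.ofReal_mul, Real.mul_self_sqrt (Nat.cast_nonneg _), Complex.ofReal_natCast]
  have hU : ‖fourierMatrix N ζ‖ = 1 :=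
    CStarRing.norm_of_mem_unitary (fourierMatrix_mem_unitary hζ)
  refine ⟨ofCorner (fourierMatrix N ζ * diagonal g * (fourierMatrix N ζ)ᴴ),
    (norm_ofCorner_le _).trans ?_, fun i hi j hj => ?_⟩
  · calc _ ≤ ‖fourierMatrix N ζ‖ * ‖diagonal g‖ * ‖(fourierMatrix N ζ)ᴴ‖ :=
          (l2_opNorm_mul _ _).trans (mul_le_mul_of_nonneg_right (l2_opNorm_mul _ _) (norm_nonneg _))
      _ ≤ 1 := by
          rw [l2_opNorm_conjTranspose, hU, l2_opNorm_diagonal, one_mul, mul_one]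
          exact (pi_norm_le_iff_of_nonneg zero_le_one).2 hg
  · have := entry_ofCorner (fourierMatrix N ζ * diagonal g * (fourierMatrix N ζ)ᴴ) ⟨i, hi⟩ ⟨j, hj⟩
    rw [this, mul_apply, sum_div]
    refine sum_congr rfl fun θ _ => ?_
    rw [mul_diagonal, conjTranspose_apply, fourierMatrix, of_apply, of_apply, star_div₀]
    simp only [RCLike.star_def, Complex.conj_ofReal, map_pow]
    rw [← Complex.inv_eq_conj hnorm, div_mul_eq_mul_div, div_mul_div_comm, hN, sub_mul,
      zpow_sub₀ hz, inv_pow]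
    congr 1
    rw [← Nat.cast_mul, ← Nat.cast_mul, zpow_natCast, zpow_natCast]
    ring

/-! ### Lower bound: testing on indicator vectors and passing to the limit. -/

lemma norm_sq_sum_single (I : Finset ℕ) :
    ‖∑ i ∈ I, (lp.single 2 i (1 : ℂ) : H)‖ ^ 2 = #I := by
  have h := lp.norm_sum_single (p := 2) (E := fun _ : ℕ => ℂ) (by norm_num) (fun _ => 1) I
  simpa using h

lemma norm_sum_entry_le (R : H →L[ℂ] H) (I J : Finset ℕ) :
    ‖∑ j ∈ J, ∑ i ∈ I, entry R i j‖ ≤ ‖R‖ * √(#I * #J) := by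
  have h : ∑ j ∈ J, ∑ i ∈ I, entry R i j = inner ℂ (∑ i ∈ I, (lp.single 2 i (1 : ℂ) : H))
      (R (∑ j ∈ J, (lp.single 2 j (1 : ℂ) : H))) := by
    simp only [entry_eq_inner, map_sum, sum_inner, inner_sum]
  have hn : ∀ I : Finset ℕ, ‖∑ i ∈ I, (lp.single 2 i (1 : ℂ) : H)‖ = √(#I) := fun I => by
    rw [← norm_sq_sum_single, Real.sqrt_sq (norm_nonneg _)]
  rw [h]
  calc _ ≤ √(#I) * (‖R‖ * √(#J)) := by
        rw [← hn I, ← hn J]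
        exact (norm_inner_le_norm _ _).trans
          (mul_le_mul_of_nonneg_left (R.le_opNorm _) (norm_nonneg _))
    _ = _ := by rw [Real.sqrt_mul (Nat.cast_nonneg _)]; ring

/-- Lower bound for the Schur multiplier norm of a Toeplitz matrix supported on the diagonals in
`K ⊆ [-m, m]`, by the mean modulus of its symbol over the `(L + 2m)`-th roots of unity. -/
lemma ofReal_le_schurNorm {m L : ℕ} (hL : 0 < L) {ζ : ℂ} (hζ : IsPrimitiveRoot ζ (L + 2 * m))
    (K : Finset ℤ) (hK : ∀ k ∈ K, |k| ≤ m) (c : ℤ → ℂ) {σ : ℝ}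
    (hσ : ((L + 2 * m : ℕ) : ℝ) * σ ≤
      ∑ θ : Fin (L + 2 * m), ‖∑ k ∈ K, c k * ζ ^ (k * (θ : ℕ))‖) :
    ENNReal.ofReal (√(L / (L + 2 * m : ℕ)) * σ) ≤
      schurNorm (toeplitz fun k => if k ∈ K then c k else 0) := by
  set N := L + 2 * m with hN
  have hN0 : 0 < N := by omega
  have : NeZero N := ⟨hN0.ne'⟩
  set f : Fin N → ℂ := fun θ => ∑ k ∈ K, c k * ζ ^ (k * (θ : ℕ)) with hf
  -- The symbol is the conjugate phase of `f`; where `f` vanishes, division by zero makes it 0,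
  -- which is harmless.
  obtain ⟨T, hT, hTe⟩ := exists_contraction_of_symbol hζ (fun θ => conj (f θ) / ‖f θ‖)
    fun θ => by
      rw [norm_div, RCLike.norm_conj, Complex.norm_real, norm_norm]
      exact div_self_le_one _
  refine le_trans ?_ (le_iSup₂ (f := fun (T : H →L[ℂ] H) (_ : ‖T‖ ≤ 1) => matrixNorm
    fun i j => toeplitz (fun k => if k ∈ K then c k else 0) i j * entry T i j) T hT)
  refine le_iInf₂ fun R hR => ?_
  rw [← ofReal_norm]
  refine ENNReal.ofReal_le_ofReal ?_
  -- For `m ≤ j < m + L` and `|k| ≤ m`, the row `j + k` lies in `[0, N)`, so these columns meet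
  -- every diagonal in `K`.
  have hcol : ∀ j ∈ Ico m (m + L), ∑ i ∈ range N, entry R i j =
      ((∑ θ, ‖f θ‖ : ℝ) : ℂ) / N := by
    intro j hj
    rw [mem_Ico] at hj
    calc ∑ i ∈ range N, entry R i j
        = ∑ i ∈ range N, (if (i : ℤ) - j ∈ K then c ((i : ℤ) - j) else 0) *
            ((∑ θ : Fin N, conj (f θ) / ‖f θ‖ * ζ ^ (((i : ℤ) - j) * (θ : ℕ))) / N) := by
          refine sum_congr rfl fun i hi => ?_
          rw [hR, ← hTe i (mem_range.1 hi) j (by omega)]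
          rfl
      _ = ∑ k ∈ K, c k * ((∑ θ : Fin N, conj (f θ) / ‖f θ‖ * ζ ^ (k * (θ : ℕ))) / N) := by
          simp only [ite_mul, zero_mul]
          rw [← sum_filter]
          refine sum_bij (fun i _ => (i : ℤ) - j) (fun i hi => (mem_filter.1 hi).2)
            (fun i _ i' _ h => by simpa using h) (fun k hk => ?_) fun i _ => rfl
          have := abs_le.1 (hK k hk)
          have hk' : (((k + j).toNat : ℕ) : ℤ) - j = k := by omega
          exact ⟨(k + j).toNat, mem_filter.2 ⟨mem_range.2 (by omega), by rwa [hk']⟩, hk'⟩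
      _ = ∑ θ, (conj (f θ) / ‖f θ‖ * f θ) / N := by
          simp only [hf, mul_sum, sum_div]
          rw [sum_comm]
          refine sum_congr rfl fun θ _ => sum_congr rfl fun k _ => ?_
          ring
      _ = _ := by
          rw [← sum_div, Complex.ofReal_sum]
          congr 1
          refine sum_congr rfl fun θ _ => ?_
          rw [div_mul_eq_mul_div, mul_comm, Complex.mul_conj']
          by_cases h : f θ = 0
          · simp [h]
          · have : (‖f θ‖ : ℂ) ≠ 0 := by simpa using h
            field_simp
  have hsum := norm_sum_entry_le R (range N) (Ico m (m + L))
  rw [sum_congr rfl hcol, sum_const, card_range, Nat.card_Ico, Nat.add_sub_cancel_left,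
    nsmul_eq_mul, norm_mul, norm_div, Complex.norm_natCast, Complex.norm_natCast,
    Complex.norm_real, Real.norm_of_nonneg (by positivity)] at hsum
  have hNr : (0 : ℝ) < N := by exact_mod_cast hN0
  have hLr : (0 : ℝ) < L := by exact_mod_cast hL
  have h1 : L * σ ≤ ‖R‖ * √(N * L) := by
    refine le_trans ?_ hsum
    gcongr
    rwa [le_div_iff₀ hNr, mul_comm]
  have h2 : √(L / N : ℝ) = L / √(N * L : ℝ) := by
    rw [eq_div_iff (by positivity), ← Real.sqrt_mul (by positivity)]
    rw [show (L / N : ℝ) * (N * L) = L * L by field_simp, Real.sqrt_mul_self hLr.le]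
  rw [h2, div_mul_eq_mul_div, div_le_iff₀ (by positivity)]
  exact h1

lemma ofReal_sqrt_mul_le_schurBound (a : ℤ → ℂ) (K : Finset ℤ) {m L : ℕ} (hL : 0 < L)
    (hK : ∀ k ∈ K, |k| ≤ m) :
    ENNReal.ofReal (√(L / (L + 2 * m : ℕ)) * (√(∑ k ∈ K, ‖a k‖ ^ 2) / √2)) ≤
      schurBound (toeplitz a) := by
  have hN0 : L + 2 * m ≠ 0 := by omega
  have hζ := Complex.isPrimitiveRoot_exp (L + 2 * m) hN0
  set ζ := Complex.exp (2 * Real.pi * Complex.I / (L + 2 * m : ℕ))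
  obtain ⟨e, he, h⟩ := exists_phases_le_sum_norm
    (fun (θ : Fin (L + 2 * m)) (k : ℤ) => ζ ^ (k * (θ : ℕ)))
    (fun θ k => by rw [norm_zpow, hζ.norm'_eq_one hN0, _root_.one_zpow]) a K
  rw [Fintype.card_fin] at h
  refine (ofReal_le_schurNorm hL hζ K hK (fun k => e k * a k) h).trans
    (le_iSup₂ (f := fun s (_ : s ∈ dominated (toeplitz a)) => schurNorm s) _ fun i j => ?_)
  simp only [toeplitz]
  split_ifs
  · rw [norm_mul, he, one_mul]
  · simp

open Filter Topology in
theorem le_schurBound_toeplitz (a : lp (fun _ : ℤ => ℂ) 2) :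
    ENNReal.ofReal (1 / √2 * ‖a‖) ≤ schurBound (toeplitz a) := by
  have hfin : ∀ K : Finset ℤ, ENNReal.ofReal (√(∑ k ∈ K, ‖a k‖ ^ 2) / √2) ≤
      schurBound (toeplitz a) := fun K => by
    have hK : ∀ k ∈ K, |k| ≤ (K.sup Int.natAbs : ℕ) := fun k hk => by
      rw [Int.abs_eq_natAbs]
      exact_mod_cast le_sup (f := Int.natAbs) hk
    set m := K.sup Int.natAbs
    -- With `K` fixed, the `2 * m` truncated columns become negligible as `L` grows.
    have hlim : Tendsto (fun L : ℕ => (L : ℝ) / (L + 2 * m : ℕ)) atTop (𝓝 1) := by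
      simpa using tendsto_natCast_div_add_atTop (2 * m : ℝ)
    have hlim' := ((Real.continuous_sqrt.tendsto 1).comp hlim).mul_const
      (√(∑ k ∈ K, ‖a k‖ ^ 2) / √2)
    rw [Real.sqrt_one, one_mul] at hlim'
    refine le_of_tendsto (ENNReal.tendsto_ofReal hlim') ?_
    filter_upwards [eventually_gt_atTop 0] with L hL
    exact ofReal_sqrt_mul_le_schurBound a K hL hK
  have hlim : Tendsto (fun K : Finset ℤ => √(∑ k ∈ K, ‖a k‖ ^ 2) / √2) atTop
      (𝓝 (1 / √2 * ‖a‖)) := by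
    have h := (summable_norm_sq a).hasSum
    rw [← norm_sq_eq_tsum] at h
    have h' := ((Real.continuous_sqrt.tendsto _).comp h).div_const √2
    rw [Real.sqrt_sq (norm_nonneg _)] at h'
    rwa [one_div_mul_eq_div]
  exact le_of_tendsto' (ENNReal.tendsto_ofReal hlim) hfin

end SchurToeplitz

theorem theorem3p4 (a : lp (fun _ : ℤ => ℂ) 2) :
    ENNReal.ofReal (1 / Real.sqrt 2 * ‖a‖) ≤ SchurToeplitz.schurBound (SchurToeplitz.toeplitz a) ∧
      SchurToeplitz.schurBound (SchurToeplitz.toeplitz a) ≤ ENNReal.ofReal ‖a‖ :=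
  ⟨SchurToeplitz.le_schurBound_toeplitz a, SchurToeplitz.schurBound_toeplitz_le a⟩
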